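/- Let $\mathbb{F}_3$ be the field with three elements. A ternary $[n,k]$ code is a $k$-dimensional linear subspace $C$ of $\mathbb{F}_3^n$; its minimum weight is the smallest number of non-zero coordinates of a non-zero vector of $C$. The code $C$ is linear complementary dual (LCD) if $C\cap C^\perp=\{0\}$, where $C^\perp=\{x\in\mathbb{F}_3^n : \sum_{i=1}^n x_iy_i=0 \text{ for all } y\in C\}$. Let $d_3(n,k)$ denote the largest minimum weight among all ternary LCD $[n,k]$ codes. (i) For every integer $s\ge 0$, \[ \begin{array}{ll} d_3(121s+17,5)=81s+9, & d_3(364s+13,6)=243s+6,\\ d_3(364s+18,6)=243s+9, & d_3(1093s+14,7)=729s+6. \end{array} \] (ii) For every integer $s\ge 0$, \[ \begin{array}{ll} d_3(40s+10,4)=27s+5, & d_3(121s+11,5)=81s+5,\\ d_3(121s+15,5)=81s+8, & d_3(364s+12,6)=243s+5,\\ d_3(1093s+13,7)=729s+5, & d_3(3280s+14,8)=2187s+5. \end{array} \] -/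

import Mathlib

/-- The dual code `C^⊥ = {x ∈ F^n | ⟨x, y⟩ = 0 for all y ∈ C}`, for the standard inner product
`⟨x, y⟩ = ∑ i, x i * y i`. -/
def dualCode {F : Type*} [Field F] {n : ℕ} (C : Submodule F (Fin n → F)) :
    Submodule F (Fin n → F) where
  carrier := {x | ∀ y ∈ C, x ⬝ᵥ y = 0}
  add_mem' := by
    intro a b ha hb y hy
    rw [add_dotProduct, ha y hy, hb y hy, add_zero]
  zero_mem' := by
    intro y _
    exact zero_dotProduct y
  smul_mem' := by
    intro c x hx y hy
    rw [smul_dotProduct, hx y hy, smul_zero]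

/-- A linear code `C` is linear complementary dual (LCD) if `C ∩ C^⊥ = {0}`. -/
def IsLCD {F : Type*} [Field F] {n : ℕ} (C : Submodule F (Fin n → F)) : Prop :=
  C ⊓ dualCode C = ⊥

/-- `C` has minimum weight `d`: `d` is the least Hamming weight of a non-zero codeword of `C`.
(No `d` qualifies for the zero code.) -/
def HasMinWeight {F : Type*} [Field F] [DecidableEq F] {n : ℕ}
    (C : Submodule F (Fin n → F)) (d : ℕ) : Prop :=
  IsLeast {w : ℕ | ∃ c ∈ C, c ≠ 0 ∧ hammingNorm c = w} d

/-- The minimum weights of the LCD `[n, k]` codes over `F`. -/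
def lcdMinWeights (F : Type*) [Field F] [DecidableEq F] (n k : ℕ) : Set ℕ :=
  {d : ℕ | ∃ C : Submodule F (Fin n → F),
    Module.finrank F C = k ∧ IsLCD C ∧ HasMinWeight C d}

/-- `d = d_q(n, k)` for `F = 𝔽_q`: `d` is the largest minimum weight among all LCD `[n, k]` codes
over `F`. This includes that an LCD `[n, k]` code with minimum weight `d` exists. -/
def IsLargestLCDMinWeight (F : Type*) [Field F] [DecidableEq F] (n k d : ℕ) : Prop :=
  IsGreatest (lcdMinWeights F n k) d

/-!
Appending to every codeword of a ternary LCD `[n, k, d]` code, `k ≥ 2`, the simplex codeword of the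
same message preserves the LCD property, because the simplex code is self-orthogonal (its weights
`3 ^ (k - 1)` are divisible by `3`). This raises `d` by `3 ^ (k - 1)` and both `n` and the Griesmer
bound for minimum weight `d + 1` by `(3 ^ k - 1) / 2`, so only `s = 0` has to be considered. There
the codes are given by generator matrices with pairwise orthogonal, non-isotropic rows, which makes
the LCD property immediate.

In (i) the minimum weight `d + 1` violates the Griesmer bound. In (ii) a code with minimum weight
`d + 1` would meet it, and `3 ∣ d + 1`. A Griesmer code is spanned by its words of minimum weight,
by induction on the residual code. If `c` is such a word and `3 ∣ d + 1`, every word of minimum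
weight in the residual code of `c` lifts to some `w` such that all of `w + a • c` have weight
`d + 1`. Since `x ⬝ᵥ x` is the weight of `x` modulo `3`, polarization gives `c ⬝ᵥ w = 0`. As `c` and
these lifts generate the code, `c` is orthogonal to it. Hence the code, being spanned by such words
`c`, is self-orthogonal and not LCD.
-/

open Finset Module Submodule

section HammingNorm

variable {F : Type*} [Field F] [DecidableEq F] {ι κ : Type*} [Fintype ι] [Fintype κ]

theorem hammingNorm_eq_sum_ite (v : ι → F) : hammingNorm v = ∑ i, if v i ≠ 0 then 1 else 0 :=
  card_filter _ _

theorem hammingNorm_comp_equiv (v : ι → F) (e : κ ≃ ι) : hammingNorm (v ∘ e) = hammingNorm v := by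
  simp only [hammingNorm_eq_sum_ite, Function.comp_apply]
  exact e.sum_comp fun i => if v i ≠ 0 then 1 else 0

theorem hammingNorm_sumElim (v : ι → F) (w : κ → F) :
    hammingNorm (Sum.elim v w) = hammingNorm v + hammingNorm w := by
  simp only [hammingNorm_eq_sum_ite]
  exact Fintype.sum_sum_type _

theorem dotProduct_self_eq_hammingNorm (v : ι → ZMod 3) : v ⬝ᵥ v = hammingNorm v := by
  have mul_self_eq_ite : ∀ x : ZMod 3, x * x = if x ≠ 0 then 1 else 0 := by decide
  simp only [dotProduct, mul_self_eq_ite, hammingNorm_eq_sum_ite, Nat.cast_sum, Nat.cast_ite,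
    Nat.cast_one, Nat.cast_zero]

theorem dotProduct_eq_zero_of_three_dvd_hammingNorm {v w : ι → ZMod 3} (hv : 3 ∣ hammingNorm v)
    (hw : 3 ∣ hammingNorm w) (hvw : 3 ∣ hammingNorm (v + w)) : v ⬝ᵥ w = 0 := by
  simp only [← ZMod.natCast_eq_zero_iff, ← dotProduct_self_eq_hammingNorm] at hv hw hvw
  have two_smul_eq_zero : 2 * (v ⬝ᵥ w) = 0 := by
    rw [add_dotProduct, dotProduct_add, dotProduct_add, hv, hw, dotProduct_comm w v] at hvw
    linear_combination hvw
  exact (mul_eq_zero.1 two_smul_eq_zero).resolve_left (by decide)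

end HammingNorm

/-- Every non-zero word of `C` has weight at least `d`. Unlike `HasMinWeight`, this allows an
arbitrary index type, so that it applies to residual codes, and `C = ⊥`. -/
def MinWeightGe {F : Type*} [Field F] [DecidableEq F] {ι : Type*} [Fintype ι]
    (C : Submodule F (ι → F)) (d : ℕ) : Prop :=
  ∀ v ∈ C, v ≠ 0 → d ≤ hammingNorm v

section Residual

variable {F : Type*} [Field F] {ι : Type*}

/-- Restriction of words to the coordinates where `c` vanishes. The image of a code `C` under it is
the residual code `Res(C, c)`. -/
def residualMap (c : ι → F) : (ι → F) →ₗ[F] ({i // c i = 0} → F) :=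
  LinearMap.funLeft F F Subtype.val

theorem residualMap_self (c : ι → F) : residualMap c c = 0 :=
  funext Subtype.property

theorem residualMap_add_smul_self (c v : ι → F) (a : F) :
    residualMap c (v + a • c) = residualMap c v := by
  rw [map_add, map_smul, residualMap_self, smul_zero, add_zero]

theorem residualMap_eq_zero_of_mem_span {c v : ι → F} (hv : v ∈ span F {c}) :
    residualMap c v = 0 := by
  obtain ⟨a, rfl⟩ := mem_span_singleton.1 hv
  rw [map_smul, residualMap_self, smul_zero]

variable [DecidableEq F] [Fintype ι]

theorem card_eq_hammingNorm_add (c : ι → F) :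
    Fintype.card ι = hammingNorm c + Fintype.card {i // c i = 0} := by
  rw [Fintype.card_subtype, add_comm]
  exact (card_filter_add_card_filter_not fun i => c i = 0).symm

variable {C : Submodule F (ι → F)} {c v : ι → F}

theorem MinWeightGe.le_hammingNorm_add_smul {d : ℕ} (hd : MinWeightGe C d) (hc : c ∈ C)
    (hv : v ∈ C) (hvc : v ∉ span F {c}) (a : F) : d ≤ hammingNorm (v + a • c) := by
  refine hd _ (C.add_mem hv (C.smul_mem a hc)) fun h => hvc ?_
  rw [eq_neg_of_add_eq_zero_left h]
  exact neg_mem (smul_mem _ a (mem_span_singleton_self c))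

theorem exists_ne_zero_minWeightGe_hammingNorm (hC : C ≠ ⊥) :
    ∃ c ∈ C, c ≠ 0 ∧ MinWeightGe C (hammingNorm c) := by
  obtain ⟨c, ⟨hc, hc0⟩, hmin⟩ := exists_minimalFor_of_wellFoundedLT
    (fun v : ι → F => v ∈ C ∧ v ≠ 0) hammingNorm (C.exists_mem_ne_zero_of_ne_bot hC)
  exact ⟨c, hc, hc0, fun v hv hv0 => (le_total _ _).elim id (hmin ⟨hv, hv0⟩)⟩

theorem inf_ker_residualMap (hd : MinWeightGe C (hammingNorm c)) (hc : c ∈ C) (hc0 : c ≠ 0) :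
    C ⊓ LinearMap.ker (residualMap c) = span F {c} := by
  refine le_antisymm ?_ ((span_singleton_le_iff_mem _ _).2 ⟨hc, residualMap_self c⟩)
  rintro v ⟨hv, hker⟩
  obtain ⟨i, hi⟩ := Function.ne_iff.1 hc0
  by_contra hvc
  -- `v` vanishes where `c` does, so cancelling its `i`th entry makes it lighter than `c`.
  refine (hd.le_hammingNorm_add_smul hc hv hvc (-(v i / c i))).not_gt (card_lt_card ?_)
  refine (ssubset_iff_of_subset fun j hj => ?_).2 ⟨i, (mem_filter_univ i).2 hi, ?_⟩
  · refine (mem_filter_univ j).2 fun hcj => (mem_filter_univ j).1 hj ?_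
    have hvj : v j = 0 := congrFun hker ⟨j, hcj⟩
    simp only [Pi.add_apply, Pi.smul_apply, hvj, hcj, smul_zero, add_zero]
  · simp only [mem_filter_univ, Pi.add_apply, Pi.smul_apply, smul_eq_mul, neg_mul,
      div_mul_cancel₀ _ hi, add_neg_cancel, ne_eq, not_true_eq_false, not_false_eq_true]

theorem finrank_map_residualMap_add_one (hd : MinWeightGe C (hammingNorm c)) (hc : c ∈ C)
    (hc0 : c ≠ 0) : finrank F (C.map (residualMap c)) + 1 = finrank F C := by
  have rank_nullity := ((residualMap c).domRestrict C).finrank_range_add_finrank_ker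
  rw [LinearMap.range_domRestrict, LinearMap.ker_domRestrict] at rank_nullity
  rw [← rank_nullity, ← finrank_span_singleton (K := F) hc0, ← inf_ker_residualMap hd hc hc0,
    ← map_comap_subtype, finrank_map_subtype_eq]

theorem le_of_map_residualMap_le {D : Submodule F (ι → F)} (hd : MinWeightGe C (hammingNorm c))
    (hcC : c ∈ C) (hc0 : c ≠ 0) (hcD : c ∈ D) (hDC : D ≤ C)
    (hres : C.map (residualMap c) ≤ D.map (residualMap c)) : C ≤ D := by
  intro v hv
  obtain ⟨w, hw, hwv⟩ := hres (mem_map_of_mem hv)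
  have hsub : v - w ∈ C ⊓ LinearMap.ker (residualMap c) :=
    ⟨C.sub_mem hv (hDC hw), LinearMap.mem_ker.2 (by rw [map_sub, hwv, sub_self])⟩
  rw [inf_ker_residualMap hd hcC hc0] at hsub
  have := D.add_mem ((span_singleton_le_iff_mem _ _).2 hcD hsub) hw
  rwa [sub_add_cancel] at this

variable [Fintype F]

theorem sum_hammingNorm_add_smul (c v : ι → F) :
    ∑ a : F, hammingNorm (v + a • c) =
      Fintype.card F * hammingNorm (residualMap c v) + (Fintype.card F - 1) * hammingNorm c := by
  have coordinate (x y : F) : ∑ a : F, (if x + a * y ≠ 0 then 1 else 0) =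
      if y = 0 then Fintype.card F * (if x ≠ 0 then 1 else 0) else Fintype.card F - 1 := by
    split_ifs with hy hx
    · simp [hy, hx]
    · simp [hy, hx]
    · have root_iff (a : F) : x + a * y ≠ 0 ↔ a ≠ -x / y := by
        rw [ne_eq, ne_eq, eq_div_iff hy, eq_neg_iff_add_eq_zero, add_comm]
      simp only [root_iff, ← card_filter, filter_ne', card_erase_of_mem (mem_univ _), card_univ]
  calc ∑ a : F, hammingNorm (v + a • c)
      = ∑ i, ∑ a : F, (if v i + a * c i ≠ 0 then 1 else 0) := by
        simp only [hammingNorm_eq_sum_ite, Pi.add_apply, Pi.smul_apply, smul_eq_mul]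
        exact sum_comm
    _ = Fintype.card F * (∑ i with c i = 0, if v i ≠ 0 then 1 else 0) +
          (Fintype.card F - 1) * #{i | c i ≠ 0} := by
        simp only [coordinate]
        rw [sum_ite, ← mul_sum, sum_const, smul_eq_mul, mul_comm (#_)]
    _ = _ := by
        rw [hammingNorm_eq_sum_ite (residualMap c v), sum_subtype _ fun i => mem_filter_univ i]
        rfl

theorem ceilDiv_le_hammingNorm_residualMap (hd : MinWeightGe C (hammingNorm c)) (hc : c ∈ C)
    (hv : v ∈ C) (hvc : v ∉ span F {c}) :
    hammingNorm c ⌈/⌉ Fintype.card F ≤ hammingNorm (residualMap c v) := by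
  have sum_le : Fintype.card F * hammingNorm c ≤ ∑ a : F, hammingNorm (v + a • c) := by
    simpa using card_nsmul_le_sum univ _ _ fun a _ =>
      hd.le_hammingNorm_add_smul hc hv hvc a
  have card_pos : 0 < Fintype.card F := Fintype.card_pos
  rw [sum_hammingNorm_add_smul, Nat.sub_mul, one_mul] at sum_le
  rw [ceilDiv_le_iff_le_mul card_pos]
  have := Nat.le_mul_of_pos_left (hammingNorm c) card_pos
  omega

theorem minWeightGe_map_residualMap (hd : MinWeightGe C (hammingNorm c)) (hc : c ∈ C) :
    MinWeightGe (C.map (residualMap c)) (hammingNorm c ⌈/⌉ Fintype.card F) := by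
  rintro _ ⟨v, hv, rfl⟩ hne
  exact ceilDiv_le_hammingNorm_residualMap hd hc hv (mt residualMap_eq_zero_of_mem_span hne)

end Residual

/-- The right-hand side `∑_{i < k} ⌈d / q ^ i⌉` of the Griesmer bound for `[n, k, d]` codes over
`𝔽_q`. -/
def griesmerLength (q k d : ℕ) : ℕ :=
  ∑ i ∈ range k, d ⌈/⌉ q ^ i

section GriesmerLength

variable {q : ℕ}

theorem griesmerLength_succ (hq : 0 < q) (k d : ℕ) :
    griesmerLength q (k + 1) d = d + griesmerLength q k (d ⌈/⌉ q) := by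
  have ceilDiv_pow_succ (i : ℕ) : d ⌈/⌉ q ^ (i + 1) = d ⌈/⌉ q ⌈/⌉ q ^ i :=
    eq_of_forall_ge_iff fun c => by
      rw [ceilDiv_le_iff_le_mul (pow_pos hq _), ceilDiv_le_iff_le_mul (pow_pos hq _),
        ceilDiv_le_iff_le_mul hq, pow_succ', mul_assoc]
  rw [griesmerLength, sum_range_succ', pow_zero, ceilDiv_one, add_comm]
  simp only [ceilDiv_pow_succ, griesmerLength]

theorem griesmerLength_mono (hq : 0 < q) (k : ℕ) : Monotone (griesmerLength q k) :=
  fun _ _ h => sum_le_sum fun _ _ => (gc_mul_ceilDiv (pow_pos hq _)).monotone_l h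

theorem griesmerLength_succ_strictMono (hq : 0 < q) (k : ℕ) :
    StrictMono (griesmerLength q (k + 1)) := fun d e h => by
  rw [griesmerLength_succ hq, griesmerLength_succ hq]
  exact add_lt_add_of_lt_of_le h
    (griesmerLength_mono hq k ((gc_mul_ceilDiv hq).monotone_l h.le))

theorem griesmerLength_pow_mul_add (hq : 0 < q) (k s d : ℕ) :
    griesmerLength q (k + 1) (q ^ k * s + d) =
      (∑ i ∈ range (k + 1), q ^ i) * s + griesmerLength q (k + 1) d := by
  induction k generalizing d with
  | zero => simp [griesmerLength]
  | succ k ih =>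
    have ceilDiv_eq : (q ^ (k + 1) * s + d) ⌈/⌉ q = q ^ k * s + d ⌈/⌉ q := by
      rw [Nat.ceilDiv_eq_add_pred_div, Nat.ceilDiv_eq_add_pred_div, pow_succ', mul_assoc,
        Nat.add_assoc, Nat.add_sub_assoc (by omega), Nat.mul_add_div hq]
    rw [griesmerLength_succ hq, ceilDiv_eq, ih, griesmerLength_succ hq (k + 1) d,
      sum_range_succ _ (k + 1)]
    ring

end GriesmerLength

section Griesmer

variable {F : Type*} [Field F] [Fintype F] [DecidableEq F] {ι : Type*} [Fintype ι]
  {C : Submodule F (ι → F)} {d : ℕ}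

theorem griesmerLength_le_card (hd : MinWeightGe C d) :
    griesmerLength (Fintype.card F) (finrank F C) d ≤ Fintype.card ι := by
  induction hk : finrank F C generalizing ι d with
  | zero => exact Nat.zero_le _
  | succ k ih =>
    have hC : C ≠ ⊥ := by rintro rfl; simp at hk
    obtain ⟨c, hc, hc0, hmin⟩ := exists_ne_zero_minWeightGe_hammingNorm hC
    have hk' : finrank F (C.map (residualMap c)) = k :=
      Nat.succ_injective ((finrank_map_residualMap_add_one hmin hc hc0).trans hk)
    calc griesmerLength (Fintype.card F) (k + 1) d
        ≤ griesmerLength (Fintype.card F) (k + 1) (hammingNorm c) :=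
          griesmerLength_mono Fintype.card_pos _ (hd c hc hc0)
      _ = hammingNorm c + griesmerLength (Fintype.card F) k (hammingNorm c ⌈/⌉ Fintype.card F) :=
          griesmerLength_succ Fintype.card_pos _ _
      _ ≤ hammingNorm c + Fintype.card {i // c i = 0} :=
          Nat.add_le_add_left (ih (minWeightGe_map_residualMap hmin hc) hk') _
      _ = Fintype.card ι := (card_eq_hammingNorm_add c).symm

/-- A code with minimum weight at least `d` meeting the Griesmer bound. -/
structure IsGriesmerCode (C : Submodule F (ι → F)) (d : ℕ) : Prop where
  minWeightGe : MinWeightGe C d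
  card_eq : Fintype.card ι = griesmerLength (Fintype.card F) (finrank F C) d

variable {c v : ι → F}

namespace IsGriesmerCode

theorem exists_hammingNorm_eq (h : IsGriesmerCode C d) (hC : C ≠ ⊥) :
    ∃ c ∈ C, c ≠ 0 ∧ hammingNorm c = d := by
  obtain ⟨c, hc, hc0, hmin⟩ := exists_ne_zero_minWeightGe_hammingNorm hC
  obtain ⟨k, hk⟩ := Nat.exists_eq_succ_of_ne_zero (mt finrank_eq_zero.1 hC)
  have length_le := (griesmerLength_le_card hmin).trans h.card_eq.le
  rw [hk, (griesmerLength_succ_strictMono Fintype.card_pos k).le_iff_le] at length_le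
  exact ⟨c, hc, hc0, length_le.antisymm (h.minWeightGe c hc hc0)⟩

theorem map_residualMap (h : IsGriesmerCode C (hammingNorm c)) (hc : c ∈ C) (hc0 : c ≠ 0) :
    IsGriesmerCode (C.map (residualMap c)) (hammingNorm c ⌈/⌉ Fintype.card F) where
  minWeightGe := minWeightGe_map_residualMap h.minWeightGe hc
  card_eq := by
    have card_eq := h.card_eq
    rw [← finrank_map_residualMap_add_one h.minWeightGe hc hc0,
      griesmerLength_succ Fintype.card_pos, card_eq_hammingNorm_add c] at card_eq
    exact Nat.add_left_cancel card_eq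

end IsGriesmerCode

theorem notMem_span_of_hammingNorm_residualMap_eq (hc0 : c ≠ 0)
    (hres : hammingNorm (residualMap c v) = hammingNorm c ⌈/⌉ Fintype.card F) :
    v ∉ span F {c} := fun hv => hc0 <| by
  rw [residualMap_eq_zero_of_mem_span hv, hammingNorm_zero] at hres
  rw [← hammingNorm_eq_zero, ← Nat.le_zero, ← mul_zero (Fintype.card F),
    ← ceilDiv_le_iff_le_mul Fintype.card_pos, hres]

theorem exists_hammingNorm_add_smul_eq (hd : MinWeightGe C (hammingNorm c)) (hc : c ∈ C)
    (hc0 : c ≠ 0) (hv : v ∈ C)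
    (hres : hammingNorm (residualMap c v) = hammingNorm c ⌈/⌉ Fintype.card F) :
    ∃ a : F, hammingNorm (v + a • c) = hammingNorm c := by
  have hvc := notMem_span_of_hammingNorm_residualMap_eq hc0 hres
  by_contra! hne
  have lt_weight (a : F) : hammingNorm c + 1 ≤ hammingNorm (v + a • c) :=
    (hd.le_hammingNorm_add_smul hc hv hvc a).lt_of_ne' (hne a)
  have le_sum : Fintype.card F * (hammingNorm c + 1) ≤ ∑ a : F, hammingNorm (v + a • c) := by
    simpa using card_nsmul_le_sum univ _ _ fun a _ => lt_weight a
  have card_pos : 0 < Fintype.card F := Fintype.card_pos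
  have ceilDiv_mul_lt : Fintype.card F * (hammingNorm c ⌈/⌉ Fintype.card F) <
      hammingNorm c + Fintype.card F := by
    have := Nat.mul_div_le (hammingNorm c + Fintype.card F - 1) (Fintype.card F)
    rw [Nat.ceilDiv_eq_add_pred_div]
    omega
  rw [sum_hammingNorm_add_smul, hres, Nat.sub_mul, one_mul, mul_add_one] at le_sum
  have := Nat.le_mul_of_pos_left (hammingNorm c) card_pos
  omega

theorem hammingNorm_add_smul_eq (hd : MinWeightGe C (hammingNorm c)) (hc : c ∈ C)
    (hc0 : c ≠ 0) (hv : v ∈ C)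
    (hres : hammingNorm (residualMap c v) = hammingNorm c ⌈/⌉ Fintype.card F)
    (hdvd : Fintype.card F ∣ hammingNorm c) (a : F) :
    hammingNorm (v + a • c) = hammingNorm c := by
  have hvc := notMem_span_of_hammingNorm_residualMap_eq hc0 hres
  have card_mul_ceilDiv :
      Fintype.card F * (hammingNorm c ⌈/⌉ Fintype.card F) = hammingNorm c := by
    obtain ⟨m, hm⟩ := hdvd
    rw [hm, ← smul_eq_mul (Fintype.card F) m, smul_ceilDiv Fintype.card_pos, smul_eq_mul]
  have sum_eq : ∑ _ : F, hammingNorm c = ∑ a : F, hammingNorm (v + a • c) := by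
    rw [sum_hammingNorm_add_smul, hres, card_mul_ceilDiv, sum_const, card_univ, smul_eq_mul,
      add_comm, ← Nat.succ_mul, Nat.succ_eq_add_one, Nat.sub_add_cancel Fintype.card_pos]
  exact ((sum_eq_sum_iff_of_le fun a _ => hd.le_hammingNorm_add_smul hc hv hvc a).1 sum_eq a
    (mem_univ a)).symm

theorem IsGriesmerCode.le_span (h : IsGriesmerCode C d) :
    C ≤ span F {v | v ∈ C ∧ hammingNorm v = d} := by
  induction hk : finrank F C generalizing ι d with
  | zero => rw [finrank_eq_zero.1 hk]; exact bot_le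
  | succ k ih =>
    have hC : C ≠ ⊥ := by rintro rfl; simp at hk
    obtain ⟨c, hc, hc0, rfl⟩ := h.exists_hammingNorm_eq hC
    have hk' : finrank F (C.map (residualMap c)) = k :=
      Nat.succ_injective ((finrank_map_residualMap_add_one h.minWeightGe hc hc0).trans hk)
    refine le_of_map_residualMap_le h.minWeightGe hc hc0 (subset_span ⟨hc, rfl⟩)
      (span_le.2 fun v hv => hv.1) ((ih (h.map_residualMap hc hc0) hk').trans (span_le.2 ?_))
    rintro _ ⟨⟨v, hv, rfl⟩, hres⟩
    obtain ⟨a, ha⟩ := exists_hammingNorm_add_smul_eq h.minWeightGe hc hc0 hv hres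
    exact ⟨v + a • c, subset_span ⟨C.add_mem hv (C.smul_mem a hc), ha⟩,
      residualMap_add_smul_self c v a⟩

end Griesmer

section TernaryGriesmer

variable {ι : Type*} [Fintype ι] {C : Submodule (ZMod 3) (ι → ZMod 3)} {d : ℕ}

theorem IsGriesmerCode.dotProduct_eq_zero_of_hammingNorm_eq {c v : ι → ZMod 3}
    (h : IsGriesmerCode C (hammingNorm c)) (hdvd : 3 ∣ hammingNorm c) (hc : c ∈ C) (hv : v ∈ C) :
    c ⬝ᵥ v = 0 := by
  obtain rfl | hc0 := eq_or_ne c 0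
  · exact zero_dotProduct v
  let D := C ⊓ LinearMap.ker (dotProductBilin (ZMod 3) (ZMod 3) c)
  suffices C ≤ D from (this hv).2
  refine le_of_map_residualMap_le h.minWeightGe hc hc0 ⟨hc, ?_⟩ inf_le_left ?_
  · exact (dotProduct_self_eq_hammingNorm c).trans ((ZMod.natCast_eq_zero_iff _ _).2 hdvd)
  refine (h.map_residualMap hc hc0).le_span.trans (span_le.2 ?_)
  rintro _ ⟨⟨w, hw, rfl⟩, hres⟩
  have coset_weight (a : ZMod 3) : hammingNorm (w + a • c) = hammingNorm c :=
    hammingNorm_add_smul_eq h.minWeightGe hc hc0 hw hres (by rwa [ZMod.card]) a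
  refine ⟨w, ⟨hw, dotProduct_eq_zero_of_three_dvd_hammingNorm hdvd ?_ ?_⟩, rfl⟩
  · rwa [← coset_weight 0, zero_smul, add_zero] at hdvd
  · rwa [← coset_weight 1, one_smul, add_comm] at hdvd

theorem IsGriesmerCode.dotProduct_eq_zero (h : IsGriesmerCode C d) (hdvd : 3 ∣ d)
    {v w : ι → ZMod 3} (hv : v ∈ C) (hw : w ∈ C) : v ⬝ᵥ w = 0 := by
  suffices C ≤ LinearMap.ker ((dotProductBilin (ZMod 3) (ZMod 3)).flip w) from this hv
  refine h.le_span.trans (span_le.2 ?_)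
  rintro c ⟨hc, rfl⟩
  exact h.dotProduct_eq_zero_of_hammingNorm_eq hdvd hc hw

end TernaryGriesmer

section LCD

variable {F : Type*} [Field F] {n : ℕ}

theorem IsLCD.eq_bot_of_dotProduct_eq_zero {C : Submodule F (Fin n → F)} (hC : IsLCD C)
    (hself : ∀ v ∈ C, ∀ w ∈ C, v ⬝ᵥ w = 0) : C = ⊥ :=
  eq_bot_iff.2 ((le_inf le_rfl hself).trans_eq hC)

variable [DecidableEq F] {k d : ℕ}

/-- There is an LCD `[n, k]` code over `F` all of whose non-zero words have weight at least `d`. -/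
def HasLCDCode (F : Type*) [Field F] [DecidableEq F] (n k d : ℕ) : Prop :=
  ∃ C : Submodule F (Fin n → F), finrank F C = k ∧ IsLCD C ∧ MinWeightGe C d

namespace HasLCDCode

theorem of_linearMap {V : Type*} [AddCommGroup V] [Module F V]
    (f : V →ₗ[F] Fin n → F) (nondegenerate : ∀ x, (∀ y, f x ⬝ᵥ f y = 0) → x = 0)
    (hd : ∀ x ≠ 0, d ≤ hammingNorm (f x)) : HasLCDCode F n (finrank F V) d := by
  have injective : Function.Injective f := (injective_iff_map_eq_zero f).2 fun x hx =>
    nondegenerate x fun y => by rw [hx, zero_dotProduct]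
  refine ⟨LinearMap.range f, LinearMap.finrank_range_of_inj injective, ?_, ?_⟩
  · refine (Submodule.eq_bot_iff _).2 ?_
    rintro _ ⟨⟨x, rfl⟩, hx⟩
    rw [nondegenerate x fun y => hx _ (LinearMap.mem_range_self f y), map_zero]
  · rintro _ ⟨x, rfl⟩ hx
    exact hd x fun h => hx (by rw [h, map_zero])

theorem of_juxtaposition {κ : Type*} [Fintype κ] {e : ℕ} {C : Submodule F (Fin n → F)}
    (hC : IsLCD C) (hd : MinWeightGe C d) (g : C →ₗ[F] κ → F)
    (selfOrthogonal : ∀ x y, g x ⬝ᵥ g y = 0) (he : ∀ x ≠ 0, e ≤ hammingNorm (g x)) :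
    HasLCDCode F (Fintype.card κ + n) (finrank F C) (e + d) := by
  have card_eq : Fintype.card (κ ⊕ Fin n) = Fintype.card κ + n := by
    rw [Fintype.card_sum, Fintype.card_fin]
  let equiv := (Fintype.equivFinOfCardEq card_eq).symm
  let f : C →ₗ[F] Fin _ → F := LinearMap.funLeft F F equiv ∘ₗ
    (LinearEquiv.sumArrowLequivProdArrow _ _ F F).symm.toLinearMap ∘ₗ g.prod C.subtype
  have f_eq (x : C) : f x = Sum.elim (g x) x ∘ equiv := rfl
  refine of_linearMap f (fun x hx => ?_) fun x hx => ?_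
  · refine Subtype.ext ((Submodule.eq_bot_iff _).1 hC x ⟨x.2, fun y hy => ?_⟩)
    have := hx ⟨y, hy⟩
    rwa [f_eq, f_eq, comp_equiv_dotProduct_comp_equiv, sumElim_dotProduct_sumElim,
      selfOrthogonal, zero_add] at this
  · rw [f_eq, hammingNorm_comp_equiv, hammingNorm_sumElim]
    exact Nat.add_le_add (he x hx) (hd x x.2 (by simpa using hx))

theorem isLargestLCDMinWeight (h : HasLCDCode F n k d) (hmax : ¬ HasLCDCode F n k (d + 1)) :
    IsLargestLCDMinWeight F n k d := by
  obtain ⟨C, hk, hlcd, hd⟩ := h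
  constructor
  · have hC : C ≠ ⊥ := by
      rintro rfl
      exact hmax ⟨⊥, hk, hlcd, fun v hv hv0 => (hv0 ((mem_bot F).1 hv)).elim⟩
    obtain ⟨c, hc, hc0, hmin⟩ := exists_ne_zero_minWeightGe_hammingNorm hC
    have weight_le : hammingNorm c ≤ d := by
      by_contra! hlt
      exact hmax ⟨C, hk, hlcd, fun v hv hv0 => hlt.trans_le (hmin v hv hv0)⟩
    refine ⟨C, hk, hlcd, ⟨c, hc, hc0, weight_le.antisymm (hd c hc hc0)⟩, ?_⟩
    rintro _ ⟨v, hv, hv0, rfl⟩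
    exact hd v hv hv0
  · rintro e ⟨D, hDk, hDlcd, -, hmin⟩
    by_contra! hlt
    exact hmax ⟨D, hDk, hDlcd, fun v hv hv0 => hlt.trans_le (hmin ⟨v, hv, hv0, rfl⟩)⟩

theorem of_orthogonal_rows {G : Fin k → Fin n → F} (hG : ∀ i j, G i ⬝ᵥ G j = 0 ↔ i ≠ j)
    (hd : ∀ m : Fin k → F, m ≠ 0 → d ≤ hammingNorm (∑ i, m i • G i)) : HasLCDCode F n k d := by
  have dotProduct_row (m : Fin k → F) (j : Fin k) :
      (∑ i, m i • G i) ⬝ᵥ G j = m j * (G j ⬝ᵥ G j) := by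
    rw [sum_dotProduct, sum_eq_single j]
    · rw [smul_dotProduct, smul_eq_mul]
    · intro i _ hij
      rw [smul_dotProduct, (hG i j).2 hij, smul_zero]
    · exact fun h => (h (mem_univ j)).elim
  rw [← finrank_fin_fun F (n := k)]
  refine of_linearMap (Fintype.linearCombination F G) (fun m hm => funext fun j => ?_) hd
  have := hm (Pi.single j 1)
  rw [Fintype.linearCombination_apply, Fintype.linearCombination_apply_single, one_smul,
    dotProduct_row] at this
  exact (mul_eq_zero.1 this).resolve_right fun h => (hG j j).1 h rfl

end HasLCDCode

theorem not_hasLCDCode_of_lt_griesmerLength [Fintype F]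
    (hn : n < griesmerLength (Fintype.card F) k d) : ¬ HasLCDCode F n k d := by
  rintro ⟨C, rfl, -, hd⟩
  exact hn.not_ge ((griesmerLength_le_card hd).trans_eq (Fintype.card_fin n))

theorem not_hasLCDCode_of_eq_griesmerLength (hn : n = griesmerLength 3 k d) (hk : k ≠ 0)
    (hdvd : 3 ∣ d) : ¬ HasLCDCode (ZMod 3) n k d := by
  rintro ⟨C, rfl, hlcd, hd⟩
  have griesmer : IsGriesmerCode C d := ⟨hd, by rwa [Fintype.card_fin, ZMod.card]⟩
  exact hk (finrank_eq_zero.2 (hlcd.eq_bot_of_dotProduct_eq_zero fun _ hv _ hw =>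
    griesmer.dotProduct_eq_zero hdvd hv hw))

end LCD

section Simplex

open scoped LinearAlgebra.Projectivization

variable {F : Type*} [Field F] {V : Type*} [AddCommGroup V] [Module F V]

theorem card_projectivization_dual [Finite F] [FiniteDimensional F V]
    [Fintype (ℙ F (Dual F V))] :
    Fintype.card (ℙ F (Dual F V)) = ∑ i ∈ range (finrank F V), Nat.card F ^ i := by
  rw [← Nat.card_eq_fintype_card,
    Projectivization.card_of_finrank F (Dual F V) Subspace.dual_finrank_eq]

theorem card_rep_mem_submodule [Finite F] (W : Submodule F V) :
    Nat.card {x : ℙ F V // x.rep ∈ W} = ∑ i ∈ range (finrank F W), Nat.card F ^ i := by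
  have range_map : Set.range (Projectivization.map W.subtype W.subtype_injective) =
      {x : ℙ F V | x.rep ∈ W} := by
    ext x
    constructor
    · rintro ⟨y, rfl⟩
      induction y using Projectivization.ind with | h w hw =>
      obtain ⟨a, ha⟩ := Projectivization.exists_smul_eq_mk_rep F (w : V) (by simpa using hw)
      rw [Set.mem_ofPred_eq, Projectivization.map_mk]
      exact ha ▸ W.smul_mem (a : F) w.2
    · intro hx
      refine ⟨.mk F ⟨x.rep, hx⟩ fun h => x.rep_nonzero (congrArg Subtype.val h), ?_⟩
      exact x.mk_rep
  rw [← Projectivization.card_of_finrank F W rfl,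
    ← Nat.card_range_of_injective (Projectivization.map_injective W.subtype W.subtype_injective),
    range_map]
  rfl

/-- The encoding map of the simplex code: the coordinates are indexed by the points of the
projective space of functionals on `V`, and a vector is evaluated at a representative of each. -/
noncomputable def simplexMap (F : Type*) {V : Type*} [Field F] [AddCommGroup V] [Module F V] :
    V →ₗ[F] ℙ F (Dual F V) → F :=
  LinearMap.pi Projectivization.rep

theorem hammingNorm_simplexMap [Finite F] [DecidableEq F] [FiniteDimensional F V]
    [Fintype (ℙ F (Dual F V))] {v : V} (hv : v ≠ 0) :
    hammingNorm (simplexMap F v) = Nat.card F ^ (finrank F V - 1) := by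
  have eval_ne_zero : Dual.eval F V v ≠ 0 := (eval_apply_eq_zero_iff F v).not.2 hv
  have finrank_ker : finrank F (LinearMap.ker (Dual.eval F V v)) + 1 = finrank F V :=
    (Dual.finrank_ker_add_one_of_ne_zero eval_ne_zero).trans Subspace.dual_finrank_eq
  have card_zeros : Fintype.card {x // simplexMap F v x = 0} =
      ∑ i ∈ range (finrank F V - 1), Nat.card F ^ i := by
    rw [← Nat.card_eq_fintype_card, ← finrank_ker, Nat.add_sub_cancel]
    exact card_rep_mem_submodule (LinearMap.ker (Dual.eval F V v))
  have card_points : Fintype.card (ℙ F (Dual F V)) =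
      Nat.card F ^ (finrank F V - 1) + ∑ i ∈ range (finrank F V - 1), Nat.card F ^ i := by
    rw [card_projectivization_dual, ← finrank_ker, Nat.add_sub_cancel, sum_range_succ, add_comm]
  rw [card_eq_hammingNorm_add (simplexMap F v), card_zeros] at card_points
  exact Nat.add_right_cancel card_points

variable [Module (ZMod 3) V] [FiniteDimensional (ZMod 3) V]
  [Fintype (ℙ (ZMod 3) (Dual (ZMod 3) V))]

theorem dotProduct_simplexMap (hV : 2 ≤ finrank (ZMod 3) V) (v w : V) :
    simplexMap (ZMod 3) v ⬝ᵥ simplexMap (ZMod 3) w = 0 := by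
  have three_dvd (u : V) : 3 ∣ hammingNorm (simplexMap (ZMod 3) u) := by
    obtain rfl | hu := eq_or_ne u 0
    · rw [map_zero, hammingNorm_zero]; exact dvd_zero 3
    · rw [hammingNorm_simplexMap hu, Nat.card_zmod]
      exact dvd_pow_self 3 (by omega)
  exact dotProduct_eq_zero_of_three_dvd_hammingNorm (three_dvd v) (three_dvd w)
    (map_add (simplexMap (ZMod 3)) v w ▸ three_dvd (v + w))

theorem HasLCDCode.add_simplex {n k d : ℕ} (hk : 2 ≤ k) (h : HasLCDCode (ZMod 3) n k d) :
    HasLCDCode (ZMod 3) ((∑ i ∈ range k, 3 ^ i) + n) k (3 ^ (k - 1) + d) := by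
  obtain ⟨C, rfl, hlcd, hd⟩ := h
  have : Finite (Dual (ZMod 3) C) := finite_of_finite (ZMod 3)
  let := Fintype.ofFinite (ℙ (ZMod 3) (Dual (ZMod 3) C))
  have card_points : Fintype.card (ℙ (ZMod 3) (Dual (ZMod 3) C)) =
      ∑ i ∈ range (finrank (ZMod 3) C), 3 ^ i := by
    rw [card_projectivization_dual, Nat.card_zmod]
  rw [← card_points]
  refine of_juxtaposition hlcd hd (simplexMap (ZMod 3)) (dotProduct_simplexMap hk) fun x hx => ?_
  rw [hammingNorm_simplexMap hx, Nat.card_zmod]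

theorem HasLCDCode.add_mul_simplex {n k d : ℕ} (hk : 2 ≤ k) (h : HasLCDCode (ZMod 3) n k d)
    (s : ℕ) : HasLCDCode (ZMod 3) ((∑ i ∈ range k, 3 ^ i) * s + n) k (3 ^ (k - 1) * s + d) := by
  induction s with
  | zero => simpa using h
  | succ s ih =>
    convert ih.add_simplex hk using 1 <;> ring

end Simplex

section TernaryRows

variable {n k d : ℕ}

/-- Boolean test that all words of the coset `v + span G` have weight at least `d`, enumerating the
coefficients `0`, `1`, `-1` of each row in turn so that the kernel evaluates it quickly. -/
def cosetWeightsGe (d : ℕ) : {k : ℕ} → (Fin k → Fin n → ZMod 3) → (Fin n → ZMod 3) → Bool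
  | 0, _, v => d ≤ hammingNorm v
  | _ + 1, G, v => cosetWeightsGe d (Fin.tail G) v && cosetWeightsGe d (Fin.tail G) (v + G 0) &&
      cosetWeightsGe d (Fin.tail G) (v - G 0)

theorem le_hammingNorm_of_cosetWeightsGe {G : Fin k → Fin n → ZMod 3} {v : Fin n → ZMod 3}
    (h : cosetWeightsGe d G v) (m : Fin k → ZMod 3) :
    d ≤ hammingNorm (v + ∑ i, m i • G i) := by
  induction k generalizing v with
  | zero => simpa [cosetWeightsGe] using h
  | succ k ih =>
    have coefficient : ∀ a : ZMod 3, a = 0 ∨ a = 1 ∨ a = -1 := by decide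
    simp only [cosetWeightsGe, Bool.and_eq_true] at h
    obtain ⟨⟨h0, h1⟩, h2⟩ := h
    rw [Fin.sum_univ_succ, ← add_assoc]
    obtain hm | hm | hm := coefficient (m 0) <;> rw [hm]
    · rw [zero_smul, add_zero]
      exact ih h0 _
    · rw [one_smul]
      exact ih h1 _
    · rw [neg_one_smul, ← sub_eq_add_neg]
      exact ih h2 _

/-- Boolean test that all non-trivial combinations of the rows of `G` have weight at least `d`. Up
to sign, the first non-zero coefficient is `1`. -/
def rowWeightsGe (d : ℕ) : {k : ℕ} → (Fin k → Fin n → ZMod 3) → Bool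
  | 0, _ => true
  | _ + 1, G => cosetWeightsGe d (Fin.tail G) (G 0) && rowWeightsGe d (Fin.tail G)

theorem le_hammingNorm_of_rowWeightsGe {G : Fin k → Fin n → ZMod 3} (h : rowWeightsGe d G)
    {m : Fin k → ZMod 3} (hm : m ≠ 0) : d ≤ hammingNorm (∑ i, m i • G i) := by
  induction k with
  | zero => exact (hm (Subsingleton.elim m 0)).elim
  | succ k ih =>
    rw [rowWeightsGe, Bool.and_eq_true] at h
    rw [Fin.sum_univ_succ]
    obtain hm0 | hm0 := eq_or_ne (m 0) 0
    · rw [hm0, zero_smul, zero_add]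
      refine ih h.2 (m := Fin.tail m) fun htail => hm (funext (Fin.cases hm0 (congrFun htail)))
    · have factor : m 0 • G 0 + ∑ i : Fin k, m i.succ • G i.succ =
          m 0 • (G 0 + ∑ i : Fin k, ((m 0)⁻¹ * m i.succ) • G i.succ) := by
        simp only [smul_add, smul_sum, smul_smul, mul_inv_cancel_left₀ hm0]
      rw [factor, hammingNorm_smul fun _ => .of_ne_zero hm0]
      exact le_hammingNorm_of_cosetWeightsGe h.1 _

theorem HasLCDCode.of_rowWeightsGe (G : Fin k → Fin n → ZMod 3)
    (orthogonal : ∀ i j, G i ⬝ᵥ G j = 0 ↔ i ≠ j) (hd : rowWeightsGe d G) :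
    HasLCDCode (ZMod 3) n k d :=
  of_orthogonal_rows orthogonal fun _ => le_hammingNorm_of_rowWeightsGe hd

end TernaryRows

theorem hasLCDCode_17_5_9 : HasLCDCode (ZMod 3) 17 5 9 :=
  .of_rowWeightsGe
    ![![0, 0, 0, 1, 0, 2, 2, 0, 1, 2, 2, 1, 2, 0, 0, 2, 2],
      ![0, 0, 0, 2, 1, 2, 0, 1, 0, 0, 1, 0, 1, 1, 1, 2, 2],
      ![1, 0, 0, 1, 2, 1, 2, 0, 2, 1, 2, 0, 1, 0, 2, 2, 0],
      ![1, 1, 1, 0, 0, 2, 1, 2, 2, 2, 2, 2, 0, 1, 0, 0, 0],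
      ![0, 1, 2, 0, 0, 2, 2, 2, 2, 1, 1, 1, 1, 1, 2, 0, 2]]
    (by decide +kernel) (by decide +kernel)

theorem hasLCDCode_13_6_6 : HasLCDCode (ZMod 3) 13 6 6 :=
  .of_rowWeightsGe
    ![![0, 0, 0, 0, 0, 1, 2, 2, 2, 1, 2, 1, 1],
      ![1, 0, 0, 0, 0, 1, 1, 2, 1, 1, 1, 0, 0],
      ![2, 1, 1, 0, 0, 2, 2, 2, 1, 1, 0, 1, 1],
      ![0, 1, 2, 0, 0, 1, 1, 2, 1, 2, 0, 1, 0],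
      ![2, 0, 0, 1, 1, 2, 2, 0, 1, 1, 1, 2, 2],
      ![0, 0, 0, 1, 2, 2, 2, 0, 1, 2, 2, 0, 1]]
    (by decide +kernel) (by decide +kernel)

theorem hasLCDCode_18_6_9 : HasLCDCode (ZMod 3) 18 6 9 :=
  .of_rowWeightsGe
    ![![0, 0, 0, 0, 1, 0, 1, 2, 0, 0, 2, 2, 2, 2, 1, 0, 1, 1],
      ![1, 0, 0, 0, 1, 0, 1, 1, 1, 2, 0, 2, 2, 1, 2, 0, 2, 0],
      ![0, 1, 1, 0, 0, 0, 2, 2, 1, 0, 1, 2, 2, 1, 0, 0, 2, 1],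
      ![2, 1, 2, 0, 0, 0, 2, 0, 1, 0, 0, 1, 1, 2, 0, 2, 2, 0],
      ![2, 1, 0, 1, 0, 1, 2, 0, 2, 2, 1, 2, 2, 1, 2, 0, 2, 0],
      ![2, 2, 0, 1, 0, 2, 2, 0, 0, 0, 0, 1, 2, 1, 1, 2, 1, 0]]
    (by decide +kernel) (by decide +kernel)

theorem hasLCDCode_14_7_6 : HasLCDCode (ZMod 3) 14 7 6 :=
  .of_rowWeightsGe
    ![![0, 0, 0, 0, 0, 1, 0, 2, 2, 2, 1, 2, 1, 1],
      ![1, 0, 0, 0, 0, 1, 0, 1, 2, 1, 1, 1, 0, 0],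
      ![0, 0, 0, 0, 0, 2, 1, 2, 0, 1, 1, 0, 2, 1],
      ![1, 1, 0, 0, 0, 2, 1, 2, 2, 2, 1, 0, 0, 0],
      ![2, 0, 1, 1, 0, 2, 2, 2, 0, 0, 0, 0, 2, 1],
      ![2, 2, 1, 2, 0, 1, 2, 1, 1, 0, 0, 0, 2, 2],
      ![2, 1, 1, 2, 1, 1, 2, 1, 2, 2, 1, 1, 2, 2]]
    (by decide +kernel) (by decide +kernel)

theorem hasLCDCode_10_4_5 : HasLCDCode (ZMod 3) 10 4 5 :=
  .of_rowWeightsGe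
    ![![1, 0, 0, 0, 2, 0, 1, 0, 1, 1],
      ![0, 0, 0, 1, 2, 1, 2, 2, 1, 2],
      ![0, 1, 0, 1, 1, 0, 0, 1, 1, 0],
      ![2, 1, 1, 1, 1, 2, 2, 1, 2, 1]]
    (by decide +kernel) (by decide +kernel)

theorem hasLCDCode_11_5_5 : HasLCDCode (ZMod 3) 11 5 5 :=
  .of_rowWeightsGe
    ![![1, 0, 0, 0, 0, 2, 0, 1, 0, 1, 1],
      ![2, 1, 1, 0, 0, 2, 1, 0, 2, 1, 2],
      ![1, 1, 2, 0, 0, 2, 0, 2, 2, 2, 0],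
      ![1, 1, 2, 0, 1, 0, 0, 0, 0, 0, 2],
      ![0, 1, 2, 1, 1, 1, 1, 1, 0, 0, 0]]
    (by decide +kernel) (by decide +kernel)

theorem hasLCDCode_15_5_8 : HasLCDCode (ZMod 3) 15 5 8 :=
  .of_rowWeightsGe
    ![![1, 0, 0, 0, 0, 2, 1, 2, 1, 1, 0, 0, 2, 2, 0],
      ![2, 1, 1, 0, 0, 1, 1, 0, 0, 1, 1, 0, 2, 1, 2],
      ![2, 1, 2, 0, 0, 0, 0, 1, 0, 0, 0, 2, 2, 2, 1],
      ![0, 0, 2, 1, 1, 0, 0, 2, 1, 0, 1, 0, 0, 2, 2],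
      ![2, 0, 1, 1, 2, 0, 0, 1, 0, 1, 1, 1, 2, 0, 2]]
    (by decide +kernel) (by decide +kernel)

theorem hasLCDCode_12_6_5 : HasLCDCode (ZMod 3) 12 6 5 :=
  .of_rowWeightsGe
    ![![1, 0, 0, 0, 0, 0, 2, 0, 1, 0, 1, 1],
      ![2, 0, 0, 0, 0, 1, 2, 2, 2, 2, 1, 0],
      ![2, 1, 0, 0, 0, 1, 1, 1, 0, 1, 1, 1],
      ![0, 0, 1, 1, 0, 1, 0, 2, 2, 2, 2, 2],
      ![2, 1, 1, 2, 0, 1, 0, 2, 1, 1, 2, 1],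
      ![2, 2, 1, 1, 1, 2, 1, 2, 1, 0, 1, 0]]
    (by decide +kernel) (by decide +kernel)

theorem hasLCDCode_13_7_5 : HasLCDCode (ZMod 3) 13 7 5 :=
  .of_rowWeightsGe
    ![![0, 0, 1, 0, 0, 0, 0, 2, 1, 1, 0, 2, 0],
      ![1, 0, 1, 0, 0, 0, 0, 2, 0, 2, 2, 1, 2],
      ![2, 0, 1, 1, 0, 0, 0, 1, 0, 2, 2, 2, 0],
      ![1, 1, 1, 1, 0, 0, 0, 0, 1, 2, 1, 1, 0],
      ![0, 1, 0, 0, 1, 0, 0, 1, 0, 1, 0, 0, 1],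
      ![2, 2, 1, 0, 0, 1, 1, 0, 2, 0, 2, 0, 1],
      ![0, 0, 2, 2, 1, 1, 2, 0, 0, 1, 0, 0, 1]]
    (by decide +kernel) (by decide +kernel)

theorem hasLCDCode_14_8_5 : HasLCDCode (ZMod 3) 14 8 5 :=
  .of_rowWeightsGe
    ![![1, 0, 0, 0, 0, 0, 0, 0, 2, 0, 1, 0, 1, 1],
      ![2, 0, 0, 0, 0, 0, 1, 0, 0, 1, 0, 2, 0, 1],
      ![2, 1, 0, 0, 0, 0, 1, 0, 2, 0, 1, 1, 0, 2],
      ![0, 0, 0, 0, 0, 0, 2, 1, 2, 2, 2, 0, 1, 2],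
      ![0, 1, 1, 0, 0, 0, 1, 1, 1, 2, 2, 0, 2, 0],
      ![0, 2, 0, 0, 0, 1, 1, 2, 2, 0, 1, 2, 0, 1],
      ![2, 1, 2, 1, 0, 1, 2, 2, 1, 1, 2, 2, 2, 1],
      ![2, 2, 2, 0, 1, 1, 1, 2, 2, 1, 1, 1, 1, 1]]
    (by decide +kernel) (by decide +kernel)

namespace HasLCDCode

variable {n k d : ℕ}

theorem isLargestLCDMinWeight_of_lt_griesmerLength (h : HasLCDCode (ZMod 3) n (k + 2) d)
    (hn : n < griesmerLength 3 (k + 2) (d + 1)) (s : ℕ) :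
    IsLargestLCDMinWeight (ZMod 3) ((∑ i ∈ range (k + 2), 3 ^ i) * s + n) (k + 2)
      (3 ^ (k + 1) * s + d) := by
  refine (h.add_mul_simplex le_add_self s).isLargestLCDMinWeight
    (not_hasLCDCode_of_lt_griesmerLength ?_)
  rw [ZMod.card]
  exact (Nat.add_lt_add_left hn _).trans_eq
    (griesmerLength_pow_mul_add three_pos (k + 1) s (d + 1)).symm

theorem isLargestLCDMinWeight_of_eq_griesmerLength (h : HasLCDCode (ZMod 3) n (k + 2) d)
    (hn : n = griesmerLength 3 (k + 2) (d + 1)) (hdvd : 3 ∣ d + 1) (s : ℕ) :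
    IsLargestLCDMinWeight (ZMod 3) ((∑ i ∈ range (k + 2), 3 ^ i) * s + n) (k + 2)
      (3 ^ (k + 1) * s + d) := by
  refine (h.add_mul_simplex le_add_self s).isLargestLCDMinWeight
    (not_hasLCDCode_of_eq_griesmerLength ?_ (k + 1).succ_ne_zero ?_)
  · exact (congrArg _ hn).trans (griesmerLength_pow_mul_add three_pos (k + 1) s (d + 1)).symm
  · rw [add_assoc]
    exact dvd_add ((dvd_pow_self 3 k.succ_ne_zero).mul_right s) hdvd

end HasLCDCode

theorem mainTheorem4 (s : ℕ) :
    (IsLargestLCDMinWeight (ZMod 3) (121 * s + 17) 5 (81 * s + 9) ∧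
      IsLargestLCDMinWeight (ZMod 3) (364 * s + 13) 6 (243 * s + 6) ∧
      IsLargestLCDMinWeight (ZMod 3) (364 * s + 18) 6 (243 * s + 9) ∧
      IsLargestLCDMinWeight (ZMod 3) (1093 * s + 14) 7 (729 * s + 6)) ∧
    (IsLargestLCDMinWeight (ZMod 3) (40 * s + 10) 4 (27 * s + 5) ∧
      IsLargestLCDMinWeight (ZMod 3) (121 * s + 11) 5 (81 * s + 5) ∧
      IsLargestLCDMinWeight (ZMod 3) (121 * s + 15) 5 (81 * s + 8) ∧
      IsLargestLCDMinWeight (ZMod 3) (364 * s + 12) 6 (243 * s + 5) ∧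
      IsLargestLCDMinWeight (ZMod 3) (1093 * s + 13) 7 (729 * s + 5) ∧
      IsLargestLCDMinWeight (ZMod 3) (3280 * s + 14) 8 (2187 * s + 5)) :=
  ⟨⟨hasLCDCode_17_5_9.isLargestLCDMinWeight_of_lt_griesmerLength (by decide) s,
      hasLCDCode_13_6_6.isLargestLCDMinWeight_of_lt_griesmerLength (by decide) s,
      hasLCDCode_18_6_9.isLargestLCDMinWeight_of_lt_griesmerLength (by decide) s,
      hasLCDCode_14_7_6.isLargestLCDMinWeight_of_lt_griesmerLength (by decide) s⟩,
    hasLCDCode_10_4_5.isLargestLCDMinWeight_of_eq_griesmerLength (by decide) (by decide) s,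
    hasLCDCode_11_5_5.isLargestLCDMinWeight_of_eq_griesmerLength (by decide) (by decide) s,
    hasLCDCode_15_5_8.isLargestLCDMinWeight_of_eq_griesmerLength (by decide) (by decide) s,
    hasLCDCode_12_6_5.isLargestLCDMinWeight_of_eq_griesmerLength (by decide) (by decide) s,
    hasLCDCode_13_7_5.isLargestLCDMinWeight_of_eq_griesmerLength (by decide) (by decide) s,
    hasLCDCode_14_8_5.isLargestLCDMinWeight_of_eq_griesmerLength (by decide) (by decide) s⟩
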